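/- Let $F$ be a (commutative) supertropical semifield with a zero element adjoined: a commutative semiring with $0$ in which, writing $\nu(a)=a+a$, one has $\nu(\nu(a))=\nu(a)$; $a+b=\nu(a)$ if $\nu(a)=\nu(b)$ and $a+b\in\{a,b\}$ otherwise; the set $\mathcal T$ of tangible elements (those not of the form $\nu(a)$) is a group under multiplication containing $1$; and $\nu$ maps $\mathcal T$ onto the set of nonzero ghosts. In an $F$-module $M$ the ghost elements are those of the form $w+w$; $v$ ghost surpasses $w$, written $v\models w$, if $v=w+c$ with $c$ ghost. A set is tropically independent if no nonempty linear combination of distinct elements of it with tangible coefficients is ghost; a d-base is a maximal tropically independent set. For functions with values in $F$, $f\models g$ is understood pointwise. A set $S$ spans $M$ if every $v\in M$ satisfies $v\models w$ for some $F$-linear combination $w$ of elements of $S$; an s-base is a minimal spanning set; a d,s-base is a d-base that is an s-base. For an $n\times n$ matrix $A$ let $|A|$ be its permanent and $\operatorname{adj}(A)$ the matrix whose $(i,j)$ entry is the permanent of the minor of $A$ with row $j$ and column $i$ deleted. $A$ is nonsingular if $|A|$ is tangible; then $A^\nabla=|A|^{-1}\operatorname{adj}(A)$, $A^{\nabla\nabla}=A^\nabla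 AA^\nabla$ and $I_A=AA^\nabla$. A set of $n$ vectors in $F^{(n)}$, forming the columns of a nonsingular matrix $A$, is closed if $I_A$ maps this set onto itself. For modules $V,W$ let $\operatorname{Hom}(V,W)$ be the $F$-module of supertropical maps, that is, of maps $\varphi$ with $\varphi(0)=0$, $\varphi(v+w)\models\varphi(v)+\varphi(w)$, and $\varphi(\alpha v)=\alpha\varphi(v)$ for $\alpha\in\mathcal T$. Theorem. Let $V$ be a submodule of $F^{(n)}$ and let $\mathcal B=\{b_1,\dots,b_n\}$ be a closed d-base of $V$ consisting of $n$ distinct vectors. Let $A$ be the matrix with columns $b_1,\dots,b_n$, let $V_{\mathcal B}$ be the $F$-submodule of $F^{(n)}$ spanned by the columns of $I_AA$ (that is, by $\mathcal B$), and let $V_{\mathcal B}^*=\operatorname{Hom}(V_{\mathcal B},F)$. For $i=1,\dots,n$ let $\varepsilon_i\in V_{\mathcal B}^*$ be given by $$\varepsilon_i(v)=(A^{\nabla\nabla}v)_i=e_i^{\mathrm T}A^{\nabla\nabla}v,$$ where $e_i$ is the $i$-th standard unit vector. Then $\varepsilon_1,\dots,\varepsilon_n$ are distinct and $\{\varepsilon_1,\dots,\varepsilon_n\}$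 is a closed d,s-base of $V_{\mathcal B}^*$, where closedness holds both when $\varepsilon_i$ is identified with the vector of its coefficients (row $i$ of $A^{\nabla\nabla}$) and when it is identified with the vector of its values $(\varepsilon_i(b_1),\dots,\varepsilon_i(b_n))$. In particular the $\varepsilon_i$ are tropically independent, and every $\ell\in V_{\mathcal B}^*$ ghost surpasses a linear combination of the $\varepsilon_i$. Moreover every $\ell\in V_{\mathcal B}^*$ is ghost surpassed by a linear combination of the $\varepsilon_i$. -/

import Mathlib

namespace Supertropical

/-- The ghost elements of a supertropical semifield or vector space `M`: those of the form
`ν(w) = w + w`.  Zero is counted as a ghost. -/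
def IsGhost {M : Type*} [AddCommMonoid M] (v : M) : Prop := ∃ w : M, v = w + w

/-- Tangible scalars: those that are not ghost (in particular they are nonzero). -/
def IsTangible {F : Type*} [CommSemiring F] (a : F) : Prop := ¬ IsGhost a

/-- `v` ghost surpasses `w`. -/
def GhostSurpasses {M : Type*} [AddCommMonoid M] (v w : M) : Prop :=
  ∃ c : M, IsGhost c ∧ v = w + c

/-- Ghost surpassing for functions, taken pointwise. -/
def PointwiseGhostSurpasses {X M : Type*} [AddCommMonoid M] (f g : X → M) : Prop :=
  ∀ x, GhostSurpasses (f x) (g x)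

/-- A (commutative) supertropical semifield with a zero element adjoined.  The ghost map is
`ν(a) = a + a` (this is forced by `add_of_nu_eq`), the nonzero ghosts are the nonzero values of
`ν`, and the tangible elements are all the remaining elements. -/
class IsSupertropicalSemifield (F : Type*) [CommSemiring F] : Prop where
  nu_idem : ∀ a : F, (a + a) + (a + a) = a + a
  add_of_nu_eq : ∀ a b : F, a + a = b + b → a + b = a + a
  add_of_nu_ne : ∀ a b : F, a + a ≠ b + b → a + b = a ∨ a + b = b
  tangible_one : IsTangible (1 : F)
  tangible_mul : ∀ a b : F, IsTangible a → IsTangible b → IsTangible (a * b)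
  tangible_inv : ∀ a : F, IsTangible a → ∃ b : F, IsTangible b ∧ a * b = 1
  nu_onto : ∀ g : F, IsGhost g → g ≠ 0 → ∃ t : F, IsTangible t ∧ t + t = g

section Bases

variable (F : Type*) [CommSemiring F] {M : Type*} [AddCommMonoid M] [Module F M]

/-- No (nonempty) linear combination with tangible coefficients of distinct elements of `S`
is ghost. -/
def TropicallyIndependent (S : Set M) : Prop :=
  ∀ s : Finset M, s.Nonempty → ↑s ⊆ S → ∀ c : M → F, (∀ v ∈ s, IsTangible (c v)) →
    ¬ IsGhost (∑ v ∈ s, c v • v)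

/-- A d-base: a maximal tropically independent set. -/
def IsDBase (S : Set M) : Prop := Maximal (TropicallyIndependent F) S

/-- `S` supertropically spans `M`: every element of `M` ghost surpasses (in the sense of the
relation `surp`) a linear combination of elements of `S`. -/
def Spans (surp : M → M → Prop) (S : Set M) : Prop :=
  ∀ v : M, ∃ w ∈ Submodule.span F S, surp v w

/-- An s-base: a minimal spanning set. -/
def IsSBase (surp : M → M → Prop) (S : Set M) : Prop := Minimal (Spans F surp) S

end Bases

section Matrices

variable {F : Type*} [CommSemiring F] {n : ℕ}

/-- `A` is nonsingular: its supertropical determinant, which is the permanent, is tangible. -/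
def Nonsingular (A : Matrix (Fin n) (Fin n) F) : Prop := IsTangible A.permanent

/-- The adjoint: its `(i, j)` entry is the permanent of the minor of `A` obtained by deleting
row `j` and column `i`. -/
def adj (A : Matrix (Fin n) (Fin n) F) : Matrix (Fin n) (Fin n) F := fun i j =>
  ∑ σ : Equiv.Perm (Fin n) with σ i = j, ∏ k ∈ Finset.univ.erase i, A (σ k) k

/-- `A^∇ = |A|⁻¹ adj A` (and `0` if `A` is singular; the units of a supertropical semifield are
the tangible elements). -/
noncomputable def nabla (A : Matrix (Fin n) (Fin n) F) : Matrix (Fin n) (Fin n) F :=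
  Ring.inverse A.permanent • adj A

/-- `A^∇∇ = A^∇ A A^∇`. -/
noncomputable def nablaNabla (A : Matrix (Fin n) (Fin n) F) : Matrix (Fin n) (Fin n) F :=
  nabla A * A * nabla A

/-- `I_A = A A^∇`. -/
noncomputable def quasiId (A : Matrix (Fin n) (Fin n) F) : Matrix (Fin n) (Fin n) F :=
  A * nabla A

/-- The matrix whose columns are the given vectors. -/
def colMatrix (b : Fin n → Fin n → F) : Matrix (Fin n) (Fin n) F := fun i j => b j i

/-- `I_A B = B`, where `B = {b_1, …, b_n}` and `A` is the matrix with columns `b_1, …, b_n`. -/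
def IsClosedFamily (b : Fin n → Fin n → F) : Prop :=
  (fun v => (quasiId (colMatrix b)).mulVec v) '' Set.range b = Set.range b

/-- The `j`-th column of `I_A A`. -/
noncomputable def barVec (b : Fin n → Fin n → F) (j : Fin n) : Fin n → F :=
  (quasiId (colMatrix b) * colMatrix b).col j

/-- `V_B`: the subspace spanned by the columns of `I_A A`. -/
noncomputable def subspaceOf (b : Fin n → Fin n → F) : Submodule F (Fin n → F) :=
  Submodule.span F (Set.range (barVec b))

/-- The `j`-th column of `I_A A` as an element of `V_B`; it is `b_j` when `B` is closed. -/
noncomputable def barVecIn (b : Fin n → Fin n → F) (j : Fin n) : subspaceOf b :=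
  ⟨barVec b j, Submodule.subset_span ⟨j, rfl⟩⟩

end Matrices

section Maps

variable (F : Type*) [CommSemiring F]

/-- Supertropical maps.  Homogeneity is for tangible scalars and for zero (the latter follows
from the former if there is more than one nonzero ghost). -/
structure IsSupertropicalMap {V W : Type*} [AddCommMonoid V] [Module F V] [AddCommMonoid W]
    [Module F W] (f : V → W) : Prop where
  map_zero : f 0 = 0
  map_add : ∀ v w : V, GhostSurpasses (f (v + w)) (f v + f w)
  map_smul : ∀ a : F, IsTangible a → ∀ v : V, f (a • v) = a • f v

/-- The space `Hom(V, W)` of supertropical maps, with the pointwise operations. -/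
def supertropicalHom (V W : Type*) [AddCommMonoid V] [Module F V] [AddCommMonoid W]
    [Module F W] : Submodule F (V → W) where
  carrier := {f | IsSupertropicalMap F f}
  zero_mem' := ⟨rfl, fun _ _ => ⟨0, ⟨0, by simp⟩, by simp⟩, fun _ _ _ => by simp⟩
  add_mem' := by
    rintro f g hf hg
    refine ⟨by simp [hf.map_zero, hg.map_zero], fun v w => ?_, fun a ha v => by
      simp [hf.map_smul a ha, hg.map_smul a ha]⟩
    obtain ⟨c, ⟨c', rfl⟩, hc⟩ := hf.map_add v w
    obtain ⟨d, ⟨d', rfl⟩, hd⟩ := hg.map_add v w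
    refine ⟨(c' + c') + (d' + d'), ⟨c' + d', by abel⟩, ?_⟩
    simp only [Pi.add_apply, hc, hd]
    abel
  smul_mem' := by
    rintro r f hf
    refine ⟨by simp [hf.map_zero], fun v w => ?_, fun a ha v => by
      simp [hf.map_smul a ha, smul_comm a r]⟩
    obtain ⟨c, ⟨c', rfl⟩, hc⟩ := hf.map_add v w
    exact ⟨r • (c' + c'), ⟨r • c', smul_add _ _ _⟩, by simp [hc]⟩

/-- The dual space `V^* = Hom(V, F)`. -/
abbrev Dual (V : Type*) [AddCommMonoid V] [Module F V] : Type _ := supertropicalHom F V F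

variable {F}

/-- The functional `ε_i` on `V_B`: `ε_i(v)` is the `i`-th coordinate of `A^∇∇ v`. -/
noncomputable def dualVec {n : ℕ} (b : Fin n → Fin n → F) (i : Fin n) : Dual F (subspaceOf b) :=
  ⟨fun v => (nablaNabla (colMatrix b)).mulVec (v : Fin n → F) i,
    ⟨by simp, fun v w => ⟨0, ⟨0, by simp⟩, by simp [Matrix.mulVec_add]⟩,
      fun a _ v => by simp [Matrix.mulVec_smul]⟩⟩

end Maps

end Supertropical

/-! Write `A` for the matrix of the `b j`. Independence makes the `b j` nonzero, so closedness
excludes a singular `A`. Each `I_A b_j` is `b_j` plus a ghost, and `I_A` permutes the finite set of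
the `b_j`. Ghost surpassing is antisymmetric, so going round a cycle of the permutation gives `I_A
b_j = b_j`, i.e. `A A^∇ A = A` (`eq_self_of_image_eq`). Then `J = A^∇ A` is idempotent, with ones on
the diagonal and ghosts off it; moreover `ε i (b j) = J i j`, and `v = ∑ ε i (v) b i` on the span.
These two facts (`IsDualPair`) yield every claim except closedness.

Superadditivity gives `l ⊨ ∑ l(b i) ε i`, which is spanning. It also gives maximality: tangible
coefficients with the ghost values of the `l(b i)` turn `l` into a dependent element. Evaluation at
`b k`, where only `ε k` is tangible, shows that no `ε k` can be dropped. A ghost combination of the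
`ε i` would force a cycle of domination among its coefficients, but 2-cycles in `J` have weight
strictly below 1 and longer ones reduce to these.

Closedness of the dual base rests on `nonsingular_and_mul_nabla_mul`: a suitable generalized inverse
`X` of `M` ghost surpasses `M^∇`, which squeezes `M M^∇ M` to `M`. -/

namespace Supertropical

open Finset Matrix

/-! ### Ghosts and the ghost surpassing relation. -/

section Ghosts

variable {M : Type*} [AddCommMonoid M]

theorem isGhost_zero : IsGhost (0 : M) := ⟨0, by simp⟩

theorem IsGhost.add {v w : M} (hv : IsGhost v) (hw : IsGhost w) : IsGhost (v + w) := by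
  obtain ⟨v, rfl⟩ := hv
  obtain ⟨w, rfl⟩ := hw
  exact ⟨v + w, by abel⟩

theorem isGhost_sum {ι : Type*} {s : Finset ι} {f : ι → M} (h : ∀ i ∈ s, IsGhost (f i)) :
    IsGhost (∑ i ∈ s, f i) :=
  Finset.sum_induction f IsGhost (fun _ _ => IsGhost.add) isGhost_zero h

theorem IsGhost.smul {F : Type*} [CommSemiring F] [Module F M] {v : M} (hv : IsGhost v) (a : F) :
    IsGhost (a • v) := by
  obtain ⟨v, rfl⟩ := hv
  exact ⟨a • v, smul_add _ _ _⟩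

theorem IsGhost.mul_left {F : Type*} [CommSemiring F] {g : F} (hg : IsGhost g) (a : F) :
    IsGhost (a * g) := hg.smul a

theorem IsGhost.mul_right {F : Type*} [CommSemiring F] {g : F} (hg : IsGhost g) (a : F) :
    IsGhost (g * a) := mul_comm a g ▸ hg.mul_left a

theorem GhostSurpasses.refl (v : M) : GhostSurpasses v v := ⟨0, isGhost_zero, by simp⟩

theorem GhostSurpasses.trans {u v w : M} (h₁ : GhostSurpasses u v) (h₂ : GhostSurpasses v w) :
    GhostSurpasses u w := by
  obtain ⟨c, hc, rfl⟩ := h₁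
  obtain ⟨d, hd, rfl⟩ := h₂
  exact ⟨d + c, hd.add hc, by abel⟩

theorem GhostSurpasses.add {v w v' w' : M} (h₁ : GhostSurpasses v w) (h₂ : GhostSurpasses v' w') :
    GhostSurpasses (v + v') (w + w') := by
  obtain ⟨c, hc, rfl⟩ := h₁
  obtain ⟨d, hd, rfl⟩ := h₂
  exact ⟨c + d, hc.add hd, by abel⟩

/-- A sum over all permutations that is invariant under a transposition is ghost. -/
theorem isGhost_sum_perm {n : Type*} [DecidableEq n] [Fintype n] {f : Equiv.Perm n → M} {i j : n}
    (hij : i ≠ j) (hf : ∀ σ, f (σ * Equiv.swap i j) = f σ) : IsGhost (∑ σ, f σ) := by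
  refine ⟨∑ σ : Equiv.Perm n with Equiv.Perm.sign σ = 1, f σ, ?_⟩
  rw [← Finset.sum_filter_add_sum_filter_not _ (fun σ : Equiv.Perm n => Equiv.Perm.sign σ = 1)]
  congr 1
  refine Finset.sum_bij' (fun σ _ => σ * Equiv.swap i j) (fun σ _ => σ * Equiv.swap i j)
    ?_ ?_ ?_ ?_ ?_
  · intro σ hσ
    have := (Int.units_eq_one_or (Equiv.Perm.sign σ)).resolve_left (by simpa using hσ)
    simp [Equiv.Perm.sign_mul, Equiv.Perm.sign_swap hij, this]
  · intro σ hσ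
    have : Equiv.Perm.sign σ = 1 := by simpa using hσ
    simp only [mem_filter, mem_univ, true_and, Equiv.Perm.sign_mul, Equiv.Perm.sign_swap hij, this]
    decide
  · intro σ _; simp [mul_assoc]
  · intro σ _; simp [mul_assoc]
  · intro σ _; exact (hf σ).symm

end Ghosts

/-! ### Permanents and the adjoint. -/

section Permanent

variable {F : Type*} [CommSemiring F] {n : ℕ}

/-- Cramer's rule: Laplace expansion along column `i`. -/
theorem adj_mulVec (A : Matrix (Fin n) (Fin n) F) (x : Fin n → F) (i : Fin n) :
    (adj A *ᵥ x) i = (A.updateCol i x).permanent := by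
  have h : ∀ σ : Equiv.Perm (Fin n), ∏ k, A.updateCol i x (σ k) k
      = (∏ k ∈ univ.erase i, A (σ k) k) * x (σ i) := fun σ => by
    rw [← Finset.prod_erase_mul _ _ (mem_univ i), updateCol_self]
    congr 1
    exact Finset.prod_congr rfl fun k hk => updateCol_ne (ne_of_mem_erase hk)
  simp only [mulVec, dotProduct, adj, permanent, h, Finset.sum_mul]
  simp only [Finset.sum_filter]
  rw [Finset.sum_comm]
  exact Finset.sum_congr rfl fun σ _ => by simp

theorem adj_apply (A : Matrix (Fin n) (Fin n) F) (i j : Fin n) :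
    adj A i j = (A.updateCol i (Pi.single j 1)).permanent := by
  rw [← adj_mulVec]; simp

theorem permanent_isGhost_of_col_eq {A : Matrix (Fin n) (Fin n) F} {i j : Fin n} (hij : i ≠ j)
    (h : ∀ k, A k i = A k j) : IsGhost A.permanent := by
  have h' : ∀ k m, A k (Equiv.swap i j m) = A k m := fun k m => by
    rcases eq_or_ne m i with rfl | hi
    · simp [h]
    rcases eq_or_ne m j with rfl | hj
    · simp [h]
    rw [Equiv.swap_apply_of_ne_of_ne hi hj]
  refine isGhost_sum_perm hij fun σ => Fintype.prod_equiv (Equiv.swap i j) _ _ fun k => ?_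
  simp [h']

/-- As in Cauchy–Binet, expand over index functions `p`. Bijective `p` give the product of
permanents; for other `p` two columns agree, and instead of cancelling they contribute a ghost. -/
theorem permanent_mul (A B : Matrix (Fin n) (Fin n) F) :
    GhostSurpasses (A * B).permanent (A.permanent * B.permanent) := by
  classical
  have h₁ : (A * B).permanent
      = ∑ p : Fin n → Fin n, ∑ σ : Equiv.Perm (Fin n), ∏ i, A (σ i) (p i) * B (p i) i := by
    simp only [permanent, mul_apply, prod_univ_sum, Fintype.piFinset_univ]
    rw [Finset.sum_comm]
  have h₂ : ∑ p : Fin n → Fin n with p.Bijective,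
        ∑ σ : Equiv.Perm (Fin n), ∏ i, A (σ i) (p i) * B (p i) i
      = ∑ τ : Equiv.Perm (Fin n), ∑ σ : Equiv.Perm (Fin n), ∏ i, A (σ i) (τ i) * B (τ i) i :=
    sum_bij (fun p h => Equiv.ofBijective p (mem_filter.1 h).2) (fun _ _ => mem_univ _)
      (fun _ _ _ _ h => by injection h)
      (fun b _ => ⟨b, mem_filter.2 ⟨mem_univ _, b.bijective⟩, Equiv.coe_fn_injective rfl⟩)
      fun _ _ => rfl
  have h₃ : ∀ τ : Equiv.Perm (Fin n), ∑ σ : Equiv.Perm (Fin n), ∏ i, A (σ i) (τ i) * B (τ i) i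
      = A.permanent * ∏ i, B (τ i) i := fun τ => by
    simp only [prod_mul_distrib, ← Finset.sum_mul]
    congr 1
    exact permanent_permute_rows τ A
  refine ⟨∑ p : Fin n → Fin n with ¬ p.Bijective,
    ∑ σ : Equiv.Perm (Fin n), ∏ i, A (σ i) (p i) * B (p i) i, isGhost_sum fun p hp => ?_, ?_⟩
  · have hp' := (mem_filter.1 hp).2
    rw [← Finite.injective_iff_bijective, Function.Injective] at hp'
    push Not at hp'
    obtain ⟨i, j, hpij, hij⟩ := hp'
    refine isGhost_sum_perm hij fun σ => ?_
    rw [prod_mul_distrib, prod_mul_distrib]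
    congr 1
    exact Fintype.prod_equiv (Equiv.swap i j) _ _ (by simp [Equiv.apply_swap_eq_self hpij])
  · rw [h₁, ← Finset.sum_filter_add_sum_filter_not _ (fun p : Fin n → Fin n => p.Bijective), h₂]
    simp only [h₃, ← Finset.mul_sum]
    rfl

end Permanent

/-! ### The total preorder of ghost values on scalars. -/

section Scalars

variable {F : Type*} [CommSemiring F]

/-- The order of ghost values: `ν(a) ≤ ν(b)`. -/
def NuLe (a b : F) : Prop := a + (b + b) = b + b

theorem NuLe.mul_left {a b : F} (h : NuLe a b) (c : F) : NuLe (c * a) (c * b) := by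
  unfold NuLe at *
  rw [← mul_add, ← mul_add, h]

theorem NuLe.mul_right {a b : F} (h : NuLe a b) (c : F) : NuLe (a * c) (b * c) := by
  simpa only [mul_comm] using h.mul_left c

theorem NuLe.trans {a b c : F} (h₁ : NuLe a b) (h₂ : NuLe b c) : NuLe a c := by
  unfold NuLe at *
  calc a + (c + c) = a + (b + (b + (c + c))) := by rw [h₂, h₂]
    _ = (a + (b + b)) + (c + c) := by abel
    _ = b + (b + (c + c)) := by rw [h₁]; abel
    _ = c + c := by rw [h₂, h₂]

theorem NuLe.add {a b c : F} (h₁ : NuLe a c) (h₂ : NuLe b c) : NuLe (a + b) c := by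
  unfold NuLe at *
  rw [add_assoc, h₂, h₁]

theorem IsTangible.ne_zero {a : F} (ha : IsTangible a) : a ≠ 0 := by
  rintro rfl
  exact ha isGhost_zero

variable [IsSupertropicalSemifield F]

theorem NuLe.refl (a : F) : NuLe a a :=
  (IsSupertropicalSemifield.add_of_nu_eq a (a + a)
    (IsSupertropicalSemifield.nu_idem a).symm)

theorem NuLe.of_add (a b : F) : NuLe a (a + b) := by
  have h := NuLe.refl a
  unfold NuLe at *
  calc a + (a + b + (a + b)) = a + (a + a) + (b + b) := by abel
    _ = a + b + (a + b) := by rw [h]; abel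

theorem NuLe.single_le_sum {ι : Type*} {s : Finset ι} (f : ι → F) {i : ι} (hi : i ∈ s) :
    NuLe (f i) (∑ j ∈ s, f j) := by
  classical
  rw [← Finset.add_sum_erase _ _ hi]
  exact NuLe.of_add _ _

theorem IsGhost.add_self {g : F} (hg : IsGhost g) : g + g = g := by
  obtain ⟨w, rfl⟩ := hg
  exact IsSupertropicalSemifield.nu_idem w

theorem NuLe.add_eq {a g : F} (h : NuLe a g) (hg : IsGhost g) : a + g = g := by
  unfold NuLe at h
  rwa [hg.add_self] at h

theorem add_eq_or_nuLe (a b : F) : a + b = a ∨ NuLe a b := by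
  by_cases h : a + a = b + b
  · right
    unfold NuLe
    rw [← h]
    exact NuLe.refl a
  · rcases IsSupertropicalSemifield.add_of_nu_ne a b h with h | h
    · exact Or.inl h
    · right
      unfold NuLe
      rw [← add_assoc, h]

theorem NuLe.total (a b : F) : NuLe a b ∨ NuLe b a := by
  rcases add_eq_or_nuLe a b with h | h
  · right
    unfold NuLe
    rw [← add_assoc, add_comm b a, h]
  · exact Or.inl h

theorem NuLe.of_le_add {a b c : F} (h : NuLe a (b + c)) : NuLe a b ∨ NuLe a c := by
  rcases NuLe.total b c with h' | h'
  · exact Or.inr (h.trans (h'.add (NuLe.refl c)))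
  · exact Or.inl (h.trans ((NuLe.refl b).add h'))

theorem NuLe.exists_of_le_sum {ι : Type*} {s : Finset ι} {f : ι → F} {a : F} (ha : a ≠ 0)
    (h : NuLe a (∑ i ∈ s, f i)) : ∃ i ∈ s, NuLe a (f i) := by
  classical
  induction s using Finset.induction_on with
  | empty => exact absurd (by simpa [NuLe] using h) ha
  | insert i s hi ih =>
    rw [Finset.sum_insert hi] at h
    rcases h.of_le_add with h | h
    · exact ⟨i, by simp, h⟩
    · obtain ⟨j, hj, h⟩ := ih h
      exact ⟨j, by simp [hj], h⟩

theorem IsTangible.isUnit {a : F} (ha : IsTangible a) : IsUnit a := by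
  obtain ⟨b, -, h⟩ := IsSupertropicalSemifield.tangible_inv a ha
  exact IsUnit.of_mul_eq_one b h

theorem isTangible_of_mul_eq_one {a b : F} (h : a * b = 1) : IsTangible b := fun hb =>
  IsSupertropicalSemifield.tangible_one (F := F) (h ▸ hb.mul_left a)

theorem IsTangible.nuLe_of_isGhost_add {a g : F} (ha : IsTangible a) (h : IsGhost (a + g)) :
    NuLe a g :=
  (add_eq_or_nuLe a g).resolve_left fun h' => ha (h' ▸ h)

theorem eq_one_of_add_ghost {a g : F} (hg : IsGhost g) (h : 1 = a + g) : a = 1 := by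
  rcases add_eq_or_nuLe a g with h' | h'
  · rw [h, h']
  · rw [h'.add_eq hg] at h
    exact absurd (h ▸ hg) IsSupertropicalSemifield.tangible_one

theorem not_nuLe_of_one_add_eq {g : F} (hg : IsGhost g) (h : 1 + g = 1) : ¬ NuLe 1 g := fun h' =>
  IsSupertropicalSemifield.tangible_one (F := F) ((h'.add_eq hg).symm.trans h ▸ hg)

/-- Adding both ghost differences changes neither element, and the larger ghost absorbs the smaller.
-/
theorem GhostSurpasses.antisymm {v w : F} (h₁ : GhostSurpasses v w) (h₂ : GhostSurpasses w v) :
    v = w := by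
  obtain ⟨c, hc, hv⟩ := h₁
  obtain ⟨d, hd, hw⟩ := h₂
  rcases NuLe.total c d with h | h
  · calc v = v + (c + d) := by rw [← add_assoc, add_right_comm, ← hw, ← hv]
      _ = w := by rw [h.add_eq hd, ← hw]
  · calc v = w + (d + c) := by rw [h.add_eq hc, ← hv]
      _ = w := by rw [← add_assoc, add_right_comm, ← hv, ← hw]

theorem GhostSurpasses.pi_antisymm {ι : Type*} {v w : ι → F} (h₁ : GhostSurpasses v w)
    (h₂ : GhostSurpasses w v) : v = w := by
  obtain ⟨_, ⟨c, rfl⟩, hv⟩ := h₁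
  obtain ⟨_, ⟨d, rfl⟩, hw⟩ := h₂
  exact funext fun i => GhostSurpasses.antisymm ⟨_, ⟨c i, rfl⟩, congrFun hv i⟩
    ⟨_, ⟨d i, rfl⟩, congrFun hw i⟩

theorem add_sum_eq_self {M ι : Type*} [AddCommMonoid M] {a : M} {s : Finset ι} {f : ι → M}
    (h : ∀ i ∈ s, a + f i = a) : a + ∑ i ∈ s, f i = a := by
  classical
  induction s using Finset.induction_on with
  | empty => simp
  | insert i s hi ih =>
    rw [Finset.sum_insert hi, ← add_assoc, h i (by simp), ih fun j hj => h j (by simp [hj])]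

/-- Every scalar has the same ghost value as some tangible scalar, unless it is zero. -/
theorem exists_tangible_add_isGhost {a : F} (ha : a ≠ 0) :
    ∃ t : F, IsTangible t ∧ IsGhost (t + a) := by
  have h0 : a + a ≠ 0 := fun h => ha (by
    have := IsSupertropicalSemifield.add_of_nu_eq a 0 (by simpa using h)
    rwa [add_zero, h] at this)
  obtain ⟨t, ht, h⟩ := IsSupertropicalSemifield.nu_onto (a + a) ⟨a, rfl⟩ h0
  exact ⟨t, ht, t, IsSupertropicalSemifield.add_of_nu_eq t a h⟩

end Scalars

end Supertropical

/-! ### Quasi-identity matrices and generalized inverses. -/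

namespace Supertropical

open Finset Matrix

variable {F : Type*} [CommSemiring F] {n : ℕ}

/-- A quasi-identity matrix: an idempotent matrix with ones on the diagonal and ghosts off the
diagonal. -/
structure IsQuasiIdentity (J : Matrix (Fin n) (Fin n) F) : Prop where
  diag : ∀ i, J i i = 1
  offDiag : ∀ i j, i ≠ j → IsGhost (J i j)
  idem : J * J = J

theorem IsQuasiIdentity.transpose {J : Matrix (Fin n) (Fin n) F} (hJ : IsQuasiIdentity J) :
    IsQuasiIdentity Jᵀ where
  diag := hJ.diag
  offDiag i j h := hJ.offDiag j i h.symm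
  idem := by rw [← transpose_mul, hJ.idem]

theorem exists_eq_one_add_of_offDiag {J : Matrix (Fin n) (Fin n) F} (hd : ∀ i, J i i = 1)
    (ho : ∀ i j, i ≠ j → IsGhost (J i j)) : ∃ C : Matrix (Fin n) (Fin n) F, J = 1 + (C + C) := by
  have : ∀ i j, ∃ c, J i j = (1 : Matrix (Fin n) (Fin n) F) i j + (c + c) := fun i j => by
    rcases eq_or_ne i j with rfl | h
    · exact ⟨0, by simp [hd]⟩
    · obtain ⟨c, hc⟩ := ho i j h
      exact ⟨c, by simp [one_apply_ne h, hc]⟩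
  choose C hC using this
  exact ⟨C, by ext i j; exact hC i j⟩

theorem isClosedFamily_of_mul_nabla_mul {b : Fin n → Fin n → F}
    (h : colMatrix b * nabla (colMatrix b) * colMatrix b = colMatrix b) : IsClosedFamily b := by
  have hcol : ∀ j, quasiId (colMatrix b) *ᵥ b j = b j := fun j => by
    ext i
    exact congrFun (congrFun h i) j
  unfold IsClosedFamily
  rw [← Set.range_comp]
  exact congrArg Set.range (funext hcol)

theorem nabla_mul_self_offDiag (A : Matrix (Fin n) (Fin n) F) (i j : Fin n) (hij : i ≠ j) :
    IsGhost ((nabla A * A) i j) := by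
  have h : (adj A * A) i j = (A.updateCol i (A.col j)).permanent := adj_mulVec A (A.col j) i
  rw [nabla, smul_mul, Matrix.smul_apply, h]
  refine IsGhost.smul (permanent_isGhost_of_col_eq hij fun k => ?_) _
  simp [hij.symm]

variable [IsSupertropicalSemifield F]

theorem nabla_mul_self_diag {A : Matrix (Fin n) (Fin n) F} (hA : Nonsingular A) (i : Fin n) :
    (nabla A * A) i i = 1 := by
  have h : (adj A * A) i i = A.permanent := by
    have := adj_mulVec A (A.col i) i
    rw [show A.updateCol i (A.col i) = A by ext; simp [updateCol_apply]; rintro rfl; rfl] at this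
    exact this
  rw [nabla, smul_mul, Matrix.smul_apply, h, smul_eq_mul, Ring.inverse_mul_cancel _ hA.isUnit]

theorem mul_nabla_mul_self {A : Matrix (Fin n) (Fin n) F} (hA : Nonsingular A) :
    ∃ C : Matrix (Fin n) (Fin n) F, A * nabla A * A = A + (C + C) := by
  obtain ⟨C, hC⟩ := exists_eq_one_add_of_offDiag (nabla_mul_self_diag hA)
    (nabla_mul_self_offDiag A)
  exact ⟨A * C, by rw [Matrix.mul_assoc, hC, Matrix.mul_add, Matrix.mul_add, Matrix.mul_one]⟩

namespace IsQuasiIdentity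

variable {J : Matrix (Fin n) (Fin n) F}

theorem nuLe_trans (hJ : IsQuasiIdentity J) (i j k : Fin n) : NuLe (J i j * J j k) (J i k) := by
  conv_rhs => rw [← hJ.idem, mul_apply]
  exact NuLe.single_le_sum (fun j => J i j * J j k) (mem_univ j)

/-- The ghost `J i k * x k` is already a summand of `x i = (J x) i`, and ghosts are additively
idempotent. -/
theorem add_mul_eq (hJ : IsQuasiIdentity J) {x : Fin n → F} (hx : J *ᵥ x = x) {i k : Fin n}
    (hik : i ≠ k) : x i + J i k * x k = x i := by
  have h : x i = ∑ j, J i j * x j := (congrFun hx i).symm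
  rw [← Finset.add_sum_erase _ _ (mem_univ k)] at h
  rw [h, add_right_comm, ((hJ.offDiag i k hik).mul_right (x k)).add_self]

/-- Since the product is ghost, being absorbed by 1 means having strictly smaller ghost value. -/
theorem mul_lt_one (hJ : IsQuasiIdentity J) {i k : Fin n} (hik : i ≠ k) :
    1 + J i k * J k i = 1 := by
  have := hJ.add_mul_eq (x := J.col i) (by
    ext m
    exact congrFun (congrFun hJ.idem m) i) hik
  simpa [hJ.diag] using this

/-- Weights of paths in a quasi-identity matrix are bounded by the entries. -/
theorem nuLe_prod (hJ : IsQuasiIdentity J) (σ : Equiv.Perm (Fin n)) (i : Fin n) :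
    NuLe (∏ k ∈ univ.erase i, J (σ k) k) (J i (σ i)) := by
  induction h : σ.support.card using Nat.strong_induction_on generalizing σ i with
  | _ N ih =>
  have moved : ∀ i, σ i ≠ i → NuLe (∏ k ∈ univ.erase i, J (σ k) k) (J i (σ i)) := by
    intro i hi
    have hii : σ (σ i) ≠ σ i := fun h => hi (σ.injective h)
    -- `τ` cuts `σ i` out of its cycle: it sends `i` to `σ (σ i)` and fixes `σ i`, so the removed
    -- factor is `J (σ (σ i)) (σ i)`.
    set τ := Equiv.swap (σ i) (σ (σ i)) * σ with hτ
    have hlt : τ.support.card < N := h ▸ Equiv.Perm.card_support_swap_mul hii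
    have hτi : τ i = σ (σ i) := by simp [hτ]
    have hτσ : τ (σ i) = σ i := by simp [hτ]
    have hτk : ∀ k, k ≠ i → k ≠ σ i → τ k = σ k := fun k h₁ h₂ => by
      simp only [hτ, Equiv.Perm.mul_apply]
      exact Equiv.swap_apply_of_ne_of_ne (fun h => h₁ (σ.injective h)) fun h => h₂ (σ.injective h)
    have hmem : σ i ∈ univ.erase i := by simp [hi]
    have key := ih _ hlt τ i rfl
    rw [← Finset.mul_prod_erase _ _ hmem, hτσ, hτi, hJ.diag, one_mul] at key
    rw [← Finset.mul_prod_erase _ _ hmem]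
    rw [Finset.prod_congr rfl (g := fun k => J (σ k) k) fun k hk => by
      simp only [mem_erase, mem_univ, and_true] at hk
      rw [hτk k hk.2 hk.1]] at key
    refine (key.mul_left _).trans ?_
    rw [mul_comm]
    exact hJ.nuLe_trans _ _ _
  by_cases hi : σ i = i
  · have hprod : ∏ k ∈ univ.erase i, J (σ k) k = ∏ k, J (σ k) k := by
      rw [← Finset.mul_prod_erase _ _ (mem_univ i), hi, hJ.diag, one_mul]
    rw [hprod, hi, hJ.diag]
    by_cases h1 : σ = 1
    · subst h1
      simpa [hJ.diag] using NuLe.refl (1 : F)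
    -- With `i` fixed, close the path at a moved point `k` instead; the whole product is then
    -- bounded by a diagonal entry.
    · obtain ⟨k, hk⟩ : ∃ k, σ k ≠ k := by
        by_contra! h
        exact h1 (Equiv.ext h)
      rw [← Finset.mul_prod_erase _ _ (mem_univ k), ← hJ.diag (σ k)]
      exact ((moved k hk).mul_left _).trans (hJ.nuLe_trans _ _ _)
  · exact moved i hi

theorem one_add_prod (hJ : IsQuasiIdentity J) {σ : Equiv.Perm (Fin n)} (hσ : σ ≠ 1) :
    1 + ∏ k, J (σ k) k = 1 := by
  obtain ⟨i, hi⟩ : ∃ i, σ i ≠ i := by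
    by_contra! h
    exact hσ (Equiv.ext h)
  have h1 := hJ.mul_lt_one hi
  have h2 := (hJ.nuLe_prod σ i).mul_left (J (σ i) i)
  rw [Finset.mul_prod_erase _ (fun k => J (σ k) k) (mem_univ i)] at h2
  rw [← h1, add_assoc, add_comm (J (σ i) i * _),
    h2.add_eq ((hJ.offDiag _ _ hi).mul_right _)]

theorem permanent_eq (hJ : IsQuasiIdentity J) : J.permanent = 1 := by
  rw [permanent, ← Finset.add_sum_erase _ _ (mem_univ 1)]
  have : ∏ k, J ((1 : Equiv.Perm (Fin n)) k) k = 1 := by simp [hJ.diag]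
  rw [this]
  exact add_sum_eq_self fun σ hσ => hJ.one_add_prod (ne_of_mem_erase hσ)

/-- The identity permutation contributes `x i`. Any other term is at most `x i` times a nontrivial
cycle product, or a ghost `J i k * x k`, and is absorbed. -/
theorem permanent_updateCol (hJ : IsQuasiIdentity J) {x : Fin n → F} (hx : J *ᵥ x = x)
    (i : Fin n) : (J.updateCol i x).permanent = x i := by
  have hσ : ∀ σ : Equiv.Perm (Fin n), ∏ k, J.updateCol i x (σ k) k
      = x (σ i) * ∏ k ∈ univ.erase i, J (σ k) k := fun σ => by
    rw [← Finset.mul_prod_erase _ _ (mem_univ i), updateCol_self]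
    congr 1
    exact Finset.prod_congr rfl fun k hk => updateCol_ne (ne_of_mem_erase hk)
  simp only [permanent, hσ]
  rw [← Finset.add_sum_erase _ _ (mem_univ 1)]
  have : x ((1 : Equiv.Perm (Fin n)) i)
      * ∏ k ∈ univ.erase i, J ((1 : Equiv.Perm (Fin n)) k) k = x i := by simp [hJ.diag]
  rw [this]
  refine add_sum_eq_self fun σ h => ?_
  by_cases hi : σ i = i
  · have h1 := hJ.one_add_prod (ne_of_mem_erase h)
    rw [← Finset.mul_prod_erase _ _ (mem_univ i), hi, hJ.diag, one_mul] at h1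
    rw [hi]
    conv_lhs => rw [← mul_one (x i), mul_assoc, one_mul, ← mul_add, h1, mul_one]
  · have h1 := hJ.add_mul_eq hx (Ne.symm hi)
    have h2 := (hJ.nuLe_prod σ i).mul_left (x (σ i))
    rw [mul_comm (x _) (J _ _)] at h2
    rw [← h1, add_assoc, add_comm (J _ _ * _),
      h2.add_eq ((hJ.offDiag _ _ (Ne.symm hi)).mul_right _)]

end IsQuasiIdentity

/-- A matrix with a reflexive generalized inverse `X` for which `X * M` is a quasi-identity is
nonsingular, and `∇` is a generalized inverse of it as well. -/
theorem nonsingular_and_mul_nabla_mul {M X : Matrix (Fin n) (Fin n) F}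
    (hJ : IsQuasiIdentity (X * M)) (hM : M * X * M = M) (hX : X * M * X = X) :
    Nonsingular M ∧ M * nabla M * M = M := by
  have h1 : X.permanent * M.permanent = 1 := by
    obtain ⟨g, hg, h⟩ := permanent_mul X M
    rw [hJ.permanent_eq] at h
    exact eq_one_of_add_ghost hg h
  have hns : Nonsingular M := isTangible_of_mul_eq_one h1
  have hinv : Ring.inverse M.permanent = X.permanent := by
    rw [← mul_one (Ring.inverse _), ← h1, mul_comm X.permanent, ← mul_assoc,
      Ring.inverse_mul_cancel _ hns.isUnit, one_mul]
  refine ⟨hns, ?_⟩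
  have hsurp : ∀ i j, ∃ c, X i j = nabla M i j + (c + c) := fun i j => by
    -- The product is `X * M` with column `i` replaced by column `j` of `X`, which `X * M` fixes;
    -- its permanent is thus `X i j`.
    obtain ⟨_, ⟨c, rfl⟩, h⟩ := permanent_mul X (M.updateCol i (Pi.single j 1))
    rw [mul_updateCol, mulVec_single_one, hJ.permanent_updateCol, ← adj_apply] at h
    · exact ⟨c, by rw [nabla, Matrix.smul_apply, smul_eq_mul, hinv, ← h]; rfl⟩
    · ext k
      exact congrFun (congrFun hX k) j
  choose C hC using hsurp
  have hXC : X = nabla M + (of C + of C) := by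
    ext i j
    exact hC i j
  obtain ⟨D, hD⟩ := mul_nabla_mul_self hns
  have hM' : M = M * nabla M * M + (M * of C * M + M * of C * M) := by
    conv_lhs => rw [← hM, hXC]
    simp only [Matrix.mul_add, Matrix.add_mul]
  ext i j
  exact GhostSurpasses.antisymm ⟨_, ⟨D i j, rfl⟩, congrFun (congrFun hD i) j⟩
    ⟨_, ⟨_, rfl⟩, congrFun (congrFun hM' i) j⟩

/-- A self-map `T` of a finite set onto itself for which each `T v` ghost surpasses `v` is the
identity. -/
theorem eq_self_of_image_eq {ι : Type*} {S : Set (ι → F)} (hS : S.Finite)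
    {T : (ι → F) → ι → F} (hT : T '' S = S) (hsurp : ∀ v ∈ S, GhostSurpasses (T v) v)
    {v : ι → F} (hv : v ∈ S) : T v = v := by
  have hmaps : Set.MapsTo T S S := fun v hv => hT ▸ Set.mem_image_of_mem T hv
  have := hS.to_subtype
  have hsurj : Function.Surjective hmaps.restrict := by
    rintro ⟨w, hw⟩
    obtain ⟨u, hu, rfl⟩ := hT.symm ▸ hw
    exact ⟨⟨u, hu⟩, rfl⟩
  let e := Equiv.ofBijective _ (Finite.injective_iff_bijective.1
    (Finite.injective_iff_surjective.2 hsurj))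
  -- With `k` one less than the order of `e` and `w = T v`, this gives `v ⊨ T v`.
  have hpow : ∀ (k : ℕ) (w : S), GhostSurpasses ((e ^ k : Equiv.Perm S) w : ι → F) w := by
    intro k
    induction k with
    | zero => exact fun w => GhostSurpasses.refl _
    | succ k ih =>
      intro w
      rw [pow_succ, Equiv.Perm.mul_apply]
      exact (ih (e w)).trans (hsurp w w.2)
  obtain ⟨m, hm⟩ : ∃ m, orderOf (e : Equiv.Perm S) = m + 1 :=
    Nat.exists_eq_succ_of_ne_zero (orderOf_pos (e : Equiv.Perm S)).ne'
  refine GhostSurpasses.pi_antisymm (hsurp v hv) ?_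
  have h := hpow m (e ⟨v, hv⟩)
  rw [← Equiv.Perm.mul_apply, ← pow_succ, ← hm, pow_orderOf_eq_one] at h
  exact h

theorem nonsingular_of_isClosedFamily {b : Fin n → Fin n → F} (hb : ∀ j, b j ≠ 0)
    (hclosed : IsClosedFamily b) : Nonsingular (colMatrix b) := by
  intro hg
  rcases Nat.eq_zero_or_pos n with rfl | hn
  · rw [permanent_isEmpty] at hg
    exact IsSupertropicalSemifield.tangible_one hg
  have hnu : ¬ IsUnit (colMatrix b).permanent := fun h => by
    obtain ⟨c, hc⟩ := h.exists_left_inv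
    exact isTangible_of_mul_eq_one hc hg
  obtain ⟨v, -, hv⟩ := hclosed.symm ▸ Set.mem_range_self (f := b) ⟨0, hn⟩
  refine hb ⟨0, hn⟩ (hv.symm.trans ?_)
  -- For a singular matrix `Ring.inverse` is 0, so `I_A` kills every vector.
  simp [quasiId, nabla, Ring.inverse_non_unit _ hnu]

theorem IsClosedFamily.mul_nabla_mul {b : Fin n → Fin n → F} (hclosed : IsClosedFamily b)
    (hns : Nonsingular (colMatrix b)) :
    colMatrix b * nabla (colMatrix b) * colMatrix b = colMatrix b := by
  obtain ⟨C, hC⟩ := mul_nabla_mul_self hns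
  have hcol : ∀ j, quasiId (colMatrix b) *ᵥ b j = (colMatrix b * nabla (colMatrix b)
      * colMatrix b).col j := fun j => rfl
  ext i j
  refine congrFun (eq_self_of_image_eq (Set.finite_range b) hclosed ?_ ⟨j, rfl⟩) i
  rintro _ ⟨j, rfl⟩
  simp only [hcol, hC]
  exact ⟨_, ⟨C.col j, rfl⟩, rfl⟩

theorem isQuasiIdentity_nabla_mul {A : Matrix (Fin n) (Fin n) F} (hA : Nonsingular A)
    (h : A * nabla A * A = A) : IsQuasiIdentity (nabla A * A) where
  diag := nabla_mul_self_diag hA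
  offDiag := nabla_mul_self_offDiag A
  idem := by rw [Matrix.mul_assoc, ← Matrix.mul_assoc A, h]

end Supertropical

/-! ### Supertropical functionals and dual pairs. -/

namespace Supertropical

open Finset Matrix

variable {F : Type*} [CommSemiring F]

section Maps

variable {V : Type*} [AddCommMonoid V] [Module F V]

theorem Dual.sum_smul_apply {ι : Type*} (s : Finset ι) (c : ι → F) (f : ι → Dual F V) (v : V) :
    (∑ i ∈ s, c i • f i).1 v = ∑ i ∈ s, c i * (f i).1 v := by
  have : (∑ i ∈ s, c i • f i).1 = ∑ i ∈ s, c i • (f i).1 := by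
    simp
  rw [this, Finset.sum_apply]
  rfl

theorem Dual.isGhost_apply {f : Dual F V} (hf : IsGhost f) (v : V) : IsGhost (f.1 v) := by
  obtain ⟨g, rfl⟩ := hf
  exact ⟨g.1 v, rfl⟩

variable [IsSupertropicalSemifield F]

/-- A nonzero ghost scalar is `t + t` with `t` tangible, so superadditivity replaces homogeneity. -/
theorem IsSupertropicalMap.map_smul_surpasses {f : V → F} (hf : IsSupertropicalMap F f) (a : F)
    (v : V) : GhostSurpasses (f (a • v)) (a * f v) := by
  by_cases ha : IsGhost a
  · rcases eq_or_ne a 0 with rfl | h0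
    · simpa [hf.map_zero] using GhostSurpasses.refl (0 : F)
    · obtain ⟨t, ht, rfl⟩ := IsSupertropicalSemifield.nu_onto a ha h0
      have := hf.map_add (t • v) (t • v)
      rwa [← add_smul, hf.map_smul t ht, smul_eq_mul, ← add_mul] at this
  · rw [hf.map_smul a ha]
    exact GhostSurpasses.refl _

theorem IsSupertropicalMap.map_sum_surpasses {f : V → F} (hf : IsSupertropicalMap F f)
    {ι : Type*} (s : Finset ι) (a : ι → F) (v : ι → V) :
    GhostSurpasses (f (∑ i ∈ s, a i • v i)) (∑ i ∈ s, a i * f (v i)) := by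
  classical
  induction s using Finset.induction_on with
  | empty => simpa [hf.map_zero] using GhostSurpasses.refl (0 : F)
  | insert i s hi ih =>
    rw [Finset.sum_insert hi, Finset.sum_insert hi]
    exact (hf.map_add _ _).trans ((hf.map_smul_surpasses _ _).add ih)

/-- Pointwise halves need not form a supertropical map, but `f = f + f`, so `f` is its own witness.
-/
theorem Dual.isGhost_of_forall {f : Dual F V} (hf : ∀ v, IsGhost (f.1 v)) : IsGhost f :=
  ⟨f, Subtype.ext (funext fun v => (hf v).add_self.symm)⟩

end Maps

/-- Functionals `ε i` that are the coordinates with respect to generators `e j`, where the matrix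
of the values `ε i (e j)` is a quasi-identity. -/
structure IsDualPair {V : Type*} [AddCommMonoid V] [Module F V] {n : ℕ} (e : Fin n → V)
    (ε : Fin n → Dual F V) : Prop where
  isQuasiIdentity : IsQuasiIdentity (Matrix.of fun i j => (ε i).1 (e j))
  repr : ∀ v, ∑ i, (ε i).1 v • e i = v

namespace IsDualPair

variable {V : Type*} [AddCommMonoid V] [Module F V] {n : ℕ} {e : Fin n → V} {ε : Fin n → Dual F V}

theorem apply_self (h : IsDualPair e ε) (i : Fin n) : (ε i).1 (e i) = 1 :=
  h.isQuasiIdentity.diag i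

theorem isGhost_apply (h : IsDualPair e ε) {i j : Fin n} (hij : i ≠ j) :
    IsGhost ((ε i).1 (e j)) :=
  h.isQuasiIdentity.offDiag i j hij

variable [IsSupertropicalSemifield F]

theorem injective (h : IsDualPair e ε) : Function.Injective ε := fun i j hij => by
  by_contra hne
  have := h.isGhost_apply (Ne.symm hne)
  rw [← hij, h.apply_self] at this
  exact IsSupertropicalSemifield.tangible_one this

theorem surpasses_sum (h : IsDualPair e ε) (l : Dual F V) (v : V) :
    GhostSurpasses (l.1 v) ((∑ i, l.1 (e i) • ε i).1 v) := by
  have := l.2.map_sum_surpasses univ (fun i => (ε i).1 v) e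
  rw [h.repr] at this
  rw [Dual.sum_smul_apply]
  simpa only [mul_comm] using this

theorem tropicallyIndependent (h : IsDualPair e ε) : TropicallyIndependent F (Set.range ε) := by
  classical
  intro s hs hsub c hc hghost
  obtain ⟨t, rfl⟩ : ∃ t : Finset (Fin n), s = t.image ε := by
    refine ⟨univ.filter fun i => ε i ∈ s, ?_⟩
    ext f
    simp only [mem_image, mem_filter, mem_univ, true_and]
    constructor
    · intro hf
      obtain ⟨i, rfl⟩ := hsub hf
      exact ⟨i, hf, rfl⟩
    · rintro ⟨i, hi, rfl⟩
      exact hi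
  rw [Finset.sum_image fun i _ j _ hij => h.injective hij] at hghost
  set β : Fin n → F := fun i => c (ε i)
  have hβ : ∀ i ∈ t, IsTangible (β i) := fun i hi => hc _ (mem_image_of_mem ε hi)
  -- `R i j` says that term `i` dominates `β j` at `e j`. It is a strict order, since `R i j` and `R
  -- j i` would give a 2-cycle of weight at least 1. Yet ghostness at `e j` gives each `j` a
  -- predecessor.
  let R : t → t → Prop := fun i j =>
    i ≠ j ∧ NuLe (β j) (β i * (ε i).1 (e j))
  have hirr : Std.Irrefl R := ⟨fun i hi => hi.1 rfl⟩
  have htri : ∀ i j k : t, R i j → R j k → NuLe (β k) (β i * ((ε i).1 (e j) * (ε j).1 (e k))) :=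
    fun i j k hij hjk => by
      rw [← mul_assoc]
      exact hjk.2.trans (hij.2.mul_right _)
  have htrans : IsTrans t R := ⟨fun i j k hij hjk => by
    have hk := htri i j k hij hjk
    refine ⟨?_, hk.trans ((h.isQuasiIdentity.nuLe_trans i j k).mul_left _)⟩
    rintro rfl
    have hne : (i : Fin n) ≠ j := fun h => hij.1 (Subtype.ext h)
    refine not_nuLe_of_one_add_eq ((h.isGhost_apply hne).mul_right ((ε j).1 (e i)))
      (h.isQuasiIdentity.mul_lt_one hne) ?_
    obtain ⟨u, -, hu⟩ := IsSupertropicalSemifield.tangible_inv _ (hβ i i.2)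
    have := hk.mul_left u
    rwa [mul_comm u, hu, ← mul_assoc, mul_comm u, hu, one_mul] at this⟩
  have hwf := Finite.wellFounded_of_trans_of_irrefl R
  obtain ⟨i₀, hi₀⟩ := Finset.image_nonempty.1 hs
  obtain ⟨j, -, hmin⟩ := hwf.has_min Set.univ ⟨⟨i₀, hi₀⟩, trivial⟩
  have hj := Dual.isGhost_apply hghost (e j)
  rw [Dual.sum_smul_apply, ← Finset.add_sum_erase _ _ j.2, h.apply_self, mul_one] at hj
  obtain ⟨i, hi, hle⟩ := ((hβ j j.2).nuLe_of_isGhost_add hj).exists_of_le_sum (hβ j j.2).ne_zero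
  have hi' := mem_erase.1 hi
  exact hmin ⟨i, hi'.2⟩ trivial ⟨fun h => hi'.1 (congrArg Subtype.val h), hle⟩

theorem isDBase (h : IsDualPair e ε) : IsDBase F (Set.range ε) := by
  classical
  refine ⟨h.tropicallyIndependent, fun S hS hsub l hl => ?_⟩
  by_contra hne
  have hlift : ∀ a : F, ∃ t : F, a ≠ 0 → IsTangible t ∧ IsGhost (t + a) := fun a => by
    rcases eq_or_ne a 0 with rfl | ha
    · exact ⟨0, fun h => absurd rfl h⟩
    · obtain ⟨t, ht, h⟩ := exists_tangible_add_isGhost ha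
      exact ⟨t, fun _ => ⟨ht, h⟩⟩
  choose τ hτ using hlift
  let t : Finset (Fin n) := univ.filter fun i => l.1 (e i) ≠ 0
  have hnot : l ∉ t.image ε := fun hmem => by
    obtain ⟨i, -, hi⟩ := mem_image.1 hmem
    exact hne ⟨i, hi⟩
  -- The default value 1 is the coefficient of `l`, which lies outside the range of `ε`.
  let c : Dual F V → F := Function.extend ε (fun i => τ (l.1 (e i))) fun _ => 1
  have hcl : c l = 1 := Function.extend_apply' _ _ _ hne
  have hcε : ∀ i, c (ε i) = τ (l.1 (e i)) := fun i => h.injective.extend_apply _ _ i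
  refine hS (insert l (t.image ε)) (insert_nonempty _ _) ?_ c ?_ ?_
  · intro f hf
    rcases mem_insert.1 (mem_coe.1 hf) with rfl | hf
    · exact hl
    · obtain ⟨i, -, rfl⟩ := mem_image.1 hf
      exact hsub ⟨i, rfl⟩
  · intro f hf
    rcases mem_insert.1 hf with rfl | hf
    · rw [hcl]
      exact IsSupertropicalSemifield.tangible_one
    · obtain ⟨i, hi, rfl⟩ := mem_image.1 hf
      rw [hcε]
      exact (hτ _ (mem_filter.1 hi).2).1
  · refine Dual.isGhost_of_forall fun v => ?_
    rw [Finset.sum_insert hnot, Finset.sum_image fun i _ j _ hij => h.injective hij]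
    obtain ⟨g, hg, hv⟩ := h.surpasses_sum l v
    have ht : (∑ i, l.1 (e i) • ε i).1 v = ∑ i ∈ t, l.1 (e i) * (ε i).1 v := by
      rw [Dual.sum_smul_apply]
      refine (Finset.sum_subset (subset_univ t) fun i _ hi => ?_).symm
      have : l.1 (e i) = 0 := by simpa [t] using hi
      rw [this, zero_mul]
    have hsum : (c l • l + ∑ i ∈ t, c (ε i) • ε i).1 v
        = ∑ i ∈ t, (τ (l.1 (e i)) + l.1 (e i)) * (ε i).1 v + g := by
      have : (c l • l + ∑ i ∈ t, c (ε i) • ε i).1 v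
          = c l * l.1 v + (∑ i ∈ t, c (ε i) • ε i).1 v := rfl
      rw [this, Dual.sum_smul_apply, hcl, one_mul, hv, ht]
      simp only [hcε, add_mul, Finset.sum_add_distrib]
      abel
    rw [hsum]
    exact (isGhost_sum fun i hi => ((hτ _ (mem_filter.1 hi).2).2).mul_right _).add hg

theorem isSBase (h : IsDualPair e ε) :
    IsSBase F (fun f g : Dual F V => PointwiseGhostSurpasses f.1 g.1) (Set.range ε) := by
  refine ⟨fun l => ⟨_, Submodule.sum_mem _ fun i _ => Submodule.smul_mem _ (l.1 (e i))
    (Submodule.subset_span ⟨i, rfl⟩), h.surpasses_sum l⟩, ?_⟩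
  rintro S hS hsub _ ⟨k, rfl⟩
  by_contra hk
  obtain ⟨w, hw, hsurp⟩ := hS (ε k)
  -- Without `ε k`, all available functionals are ghost at `e k`, whereas `ε k` is 1 there.
  have hghost : IsGhost (w.1 (e k)) := by
    clear hsurp
    induction hw using Submodule.span_induction with
    | mem f hf =>
      obtain ⟨i, rfl⟩ := hsub hf
      exact h.isGhost_apply fun hik => hk (hik ▸ hf)
    | zero => exact isGhost_zero
    | add f g _ _ hf hg => exact hf.add hg
    | smul a f _ hf => exact hf.smul a
  obtain ⟨g, hg, heq⟩ := hsurp (e k)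
  rw [h.apply_self] at heq
  exact IsSupertropicalSemifield.tangible_one (heq ▸ hghost.add hg)

theorem exists_sum_surpasses (h : IsDualPair e ε) (l : Dual F V) :
    ∃ β : Fin n → F, PointwiseGhostSurpasses (∑ i, β i • ε i).1 l.1 := by
  set u : V := ∑ i, e i with hu
  -- One coefficient serves for all `i`. With `g` the ghost of `∑ ε i (v)`, `g • u` absorbs `v`, so
  -- `l v` is dominated by `l (g • u)`. Doubling `u` allows `g • u = t • (u + u)` with `t` tangible,
  -- to which homogeneity applies.
  set m : F := l.1 (u + u) + l.1 (u + u) with hm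
  refine ⟨fun _ => m, fun v => ?_⟩
  have hmg : IsGhost m := ⟨_, rfl⟩
  set g : F := ∑ i, (ε i).1 v + ∑ i, (ε i).1 v with hg
  have hsum : (∑ i, m • ε i).1 v = m * g := by
    rw [Dual.sum_smul_apply, ← Finset.mul_sum, hg, mul_add, (hmg.mul_right _).add_self]
  have hgg : IsGhost g := ⟨_, rfl⟩
  suffices hle : NuLe (l.1 v) (m * g) by
    refine ⟨m * g, hgg.mul_left _, ?_⟩
    rw [hsum, hle.add_eq (hgg.mul_left _)]
  have hle : ∀ i, (ε i).1 v + g = g := fun i => NuLe.single_le_sum (fun i => (ε i).1 v) (mem_univ i)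
  have hv : v + g • u = g • u := by
    conv_lhs => rw [← h.repr v]
    rw [hu, Finset.smul_sum, ← Finset.sum_add_distrib]
    exact Finset.sum_congr rfl fun i _ => by rw [← add_smul, hle]
  rcases eq_or_ne g 0 with h0 | h0
  · have : v = 0 := by simpa [h0] using hv
    rw [this, l.2.map_zero]
    simp [NuLe]
  · obtain ⟨t, ht, htg⟩ := IsSupertropicalSemifield.nu_onto g hgg h0
    have hgu : g • u = t • (u + u) := by rw [← htg, add_smul, smul_add]
    obtain ⟨d, -, hd⟩ := l.2.map_add v (g • u)
    rw [hv, hgu, l.2.map_smul t ht, smul_eq_mul] at hd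
    have h1 : NuLe (l.1 v) (t * l.1 (u + u)) := by
      conv_rhs => rw [hd, add_assoc]
      exact NuLe.of_add _ _
    have h2 : m * g = t * l.1 (u + u) + t * l.1 (u + u) := by
      calc m * g = t * l.1 (u + u) + t * l.1 (u + u) + (t * l.1 (u + u) + t * l.1 (u + u)) := by
            rw [← htg, hm]
            ring
        _ = _ := IsSupertropicalSemifield.nu_idem _
    unfold NuLe at h1 ⊢
    rw [(hgg.mul_left m).add_self, h2, h1]

end IsDualPair

theorem isDualPair_dualVec [IsSupertropicalSemifield F] {n : ℕ} {b : Fin n → Fin n → F}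
    (hns : Nonsingular (colMatrix b))
    (h : colMatrix b * nabla (colMatrix b) * colMatrix b = colMatrix b) :
    IsDualPair (barVecIn b) (dualVec b) := by
  set A := colMatrix b with hA
  have hNA : nablaNabla A * A = nabla A * A := by
    rw [nablaNabla, Matrix.mul_assoc, Matrix.mul_assoc, ← Matrix.mul_assoc A, h]
  have hbar : ∀ j, barVec b j = A.col j := fun j => by
    rw [barVec, quasiId, ← hA, h]
  refine ⟨?_, fun v => Subtype.ext ?_⟩
  · convert isQuasiIdentity_nabla_mul hns h using 1
    ext i j
    rw [← hNA]
    change (nablaNabla A *ᵥ barVec b j) i = _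
    rw [hbar]
    rfl
  · have hmul : ∀ x : Fin n → F, ∑ i, x i • A.col i = A *ᵥ x := fun x => by
      rw [mulVec_eq_sum]
      simp
      rfl
    obtain ⟨α, hα⟩ := (Submodule.mem_span_range_iff_exists_fun F).1 v.2
    simp only [hbar, hmul] at hα
    have hsum : ((∑ i, (dualVec b i).1 v • barVecIn b i : subspaceOf b) : Fin n → F)
        = ∑ i, (nablaNabla A *ᵥ (v : Fin n → F)) i • A.col i := by
      rw [Submodule.coe_sum]
      exact Finset.sum_congr rfl fun i _ => by rw [← hbar]; rfl
    rw [hsum, hmul, ← hα, mulVec_mulVec, mulVec_mulVec, Matrix.mul_assoc, hNA,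
      ← Matrix.mul_assoc, h]

end Supertropical

/-! ### The dual base theorem. -/

open Supertropical in
theorem mainTheorem1 {F : Type*} [CommSemiring F] [Supertropical.IsSupertropicalSemifield F]
    {n : ℕ} (V : Submodule F (Fin n → F)) (b : Fin n → V) (hinj : Function.Injective b)
    (hbase : Supertropical.IsDBase F (Set.range b))
    (hclosed : Supertropical.IsClosedFamily (fun j => (b j : Fin n → F))) :
    let B : Fin n → Fin n → F := fun j => (b j : Fin n → F)
    let ε : Fin n → Supertropical.Dual F (Supertropical.subspaceOf B) := Supertropical.dualVec B
    -- the `ε i` are distinct and form a d-base of the dual space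
    Function.Injective ε ∧
    Supertropical.IsDBase F (Set.range ε) ∧
    -- they form an s-base of the dual space
    Supertropical.IsSBase F (fun f g => Supertropical.PointwiseGhostSurpasses f.1 g.1)
      (Set.range ε) ∧
    -- this base is closed, when `ε i` is written as the row vector (row `i` of `A^∇∇`)
    -- that represents it
    (Supertropical.Nonsingular
        (Supertropical.colMatrix (Supertropical.nablaNabla (Supertropical.colMatrix B))) ∧
      Supertropical.IsClosedFamily (Supertropical.nablaNabla (Supertropical.colMatrix B))) ∧
    -- and also when `ε i` is written as the vector of its values on `b_1, …, b_n`
    (Supertropical.Nonsingular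
        (Supertropical.colMatrix fun i j => (ε i).1 (Supertropical.barVecIn B j)) ∧
      Supertropical.IsClosedFamily fun i j => (ε i).1 (Supertropical.barVecIn B j)) ∧
    -- every functional is ghost-surpassed by a combination of the `ε i`
    (∀ l : Supertropical.Dual F (Supertropical.subspaceOf B), ∃ β : Fin n → F,
      Supertropical.PointwiseGhostSurpasses (∑ i, β i • ε i).1 l.1) := by
  intro B ε
  have hB : ∀ j, B j ≠ 0 := fun j hj => by
    refine hbase.1 {b j} (Finset.singleton_nonempty _) (by simp) (fun _ => 1)
      (fun _ _ => IsSupertropicalSemifield.tangible_one) ?_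
    rw [Finset.sum_singleton, show b j = 0 from Subtype.ext hj, smul_zero]
    exact isGhost_zero
  have hns : Nonsingular (colMatrix B) := nonsingular_of_isClosedFamily hB hclosed
  have hA := IsClosedFamily.mul_nabla_mul hclosed hns
  have hpair : IsDualPair (barVecIn B) ε := isDualPair_dualVec hns hA
  refine ⟨hpair.injective, hpair.isDBase, hpair.isSBase, ?_, ?_, hpair.exists_sum_surpasses⟩
  · set A := colMatrix B
    have hNA : nablaNabla A * A = nabla A * A := by
      rw [nablaNabla, Matrix.mul_assoc, Matrix.mul_assoc, ← Matrix.mul_assoc A, hA]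
    have hAN : A * nablaNabla A = A * nabla A := by
      rw [nablaNabla, ← Matrix.mul_assoc, ← Matrix.mul_assoc, hA]
    have hcol : colMatrix (nablaNabla A) = (nablaNabla A).transpose := rfl
    have key : Nonsingular (colMatrix (nablaNabla A)) ∧
        colMatrix (nablaNabla A) * nabla (colMatrix (nablaNabla A)) * colMatrix (nablaNabla A)
          = colMatrix (nablaNabla A) := by
      -- `A` and `A^∇∇` are generalized inverses of each other; transposing turns the rows of `A^∇∇`
      -- into columns.
      refine nonsingular_and_mul_nabla_mul (X := A.transpose) ?_ ?_ ?_
      · rw [hcol, ← Matrix.transpose_mul, hNA]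
        exact (isQuasiIdentity_nabla_mul hns hA).transpose
      · rw [hcol, ← Matrix.transpose_mul, ← Matrix.transpose_mul, hAN, nablaNabla,
          Matrix.mul_assoc (nabla A * A), ← Matrix.mul_assoc (nabla A), ← Matrix.mul_assoc,
          (isQuasiIdentity_nabla_mul hns hA).idem]
      · rw [hcol, ← Matrix.transpose_mul, ← Matrix.transpose_mul, hNA, ← Matrix.mul_assoc, hA]
    exact ⟨key.1, isClosedFamily_of_mul_nabla_mul key.2⟩
  · have hJ : IsQuasiIdentity (colMatrix fun i j => (ε i).1 (barVecIn B j)) :=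
      hpair.isQuasiIdentity.transpose
    -- The matrix of values is idempotent, hence its own generalized inverse.
    have key := nonsingular_and_mul_nabla_mul (by rwa [hJ.idem]) (by rw [hJ.idem, hJ.idem])
      (by rw [hJ.idem, hJ.idem])
    exact ⟨key.1, isClosedFamily_of_mul_nabla_mul key.2⟩
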